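/- Let $d\ge 1$, and let $A_0,A_1\in \mathrm{SU}(d)$ be such that the subgroup generated by $\{A_0,A_1\}$ is dense in $\mathrm{SU}(d)$. Let $c_1,c_2,\dots$ be independent, identically distributed random variables with values in $\{0,1\}$ on a probability space, with $\Pr[c_n=0]>0$ and $\Pr[c_n=1]>0$. Put $U(0)=\mathbb{1}$ and $U(n)=A_{c_n}A_{c_{n-1}}\cdots A_{c_1}$ for $n\ge 1$. Then, with probability one over the realization of $c_1c_2c_3\cdots$, the evolution $U$ satisfies complete Hilbert-space ergodicity: for every $k\in\mathbb{N}$ and every unit vector $|\psi\rangle\in\mathbb{C}^d$, $$\lim_{N\to\infty}\frac1N\sum_{n=0}^{N-1}\bigl(U(n)|\psi\rangle\langle\psi|U(n)^\dagger\bigr)^{\otimes k}=\int_{\mathrm{SU}(d)}\bigl(U|\psi\rangle\langle\psi|U^\dagger\bigr)^{\otimes k}\,dU,$$ where $dU$ is the normalized Haar measure on $\mathrm{SU}(d)$. (The event of probability one does not depend on $k$ or $|\psi\rangle$.) -/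

import Mathlib

open MeasureTheory ProbabilityTheory Filter Topology

namespace CHSE

/-- The special unitary group `SU(d)`, as a type, with the topology induced from complex matrices. -/
abbrev SU (d : ℕ) : Type := ↥(Matrix.specialUnitaryGroup (Fin d) ℂ)

/-- `SU(d)` carries its Borel sigma-algebra. -/
noncomputable instance instMeasurableSpaceSU (d : ℕ) : MeasurableSpace (SU d) := borel (SU d)

instance instBorelSpaceSU (d : ℕ) : BorelSpace (SU d) := ⟨rfl⟩

instance instIsTopologicalGroupSU (d : ℕ) : IsTopologicalGroup (SU d) where
  continuous_inv := by
    refine Continuous.subtype_mk ?_ _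
    exact continuous_star.comp continuous_subtype_val

theorem isCompact_specialUnitaryGroup (d : ℕ) :
    IsCompact (Matrix.specialUnitaryGroup (Fin d) ℂ : Set (Matrix (Fin d) (Fin d) ℂ)) := by
  have hbox : IsCompact
      (Set.pi Set.univ fun _ : Fin d => Set.pi Set.univ fun _ : Fin d =>
        Metric.closedBall (0 : ℂ) 1) :=
    isCompact_univ_pi fun _ => isCompact_univ_pi fun _ => isCompact_closedBall _ _
  refine IsCompact.of_isClosed_subset hbox ?_ ?_
  · have h : (Matrix.specialUnitaryGroup (Fin d) ℂ : Set (Matrix (Fin d) (Fin d) ℂ)) =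
        {A | A * star A = 1} ∩ {A | A.det = 1} := by
      ext A
      simp [Matrix.mem_specialUnitaryGroup_iff, Matrix.mem_unitaryGroup_iff]
    rw [h]
    exact (isClosed_eq (continuous_id.mul continuous_star) continuous_const).inter
      (isClosed_eq continuous_id.matrix_det continuous_const)
  · intro A hA i _ j _
    rw [mem_closedBall_zero_iff]
    exact entry_norm_bound_of_unitary (Matrix.specialUnitaryGroup_le_unitaryGroup hA) i j

instance instCompactSpaceSU (d : ℕ) : CompactSpace (SU d) :=
  isCompact_iff_compactSpace.mp (isCompact_specialUnitaryGroup d)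

/-- The Haar measure of `SU(d)`, normalised to total mass one. -/
noncomputable def haarSU (d : ℕ) : Measure (SU d) := Measure.haarMeasure ⊤

instance instIsHaarMeasureHaarSU (d : ℕ) : (haarSU d).IsHaarMeasure := by
  unfold haarSU
  infer_instance

instance instIsProbabilityMeasureHaarSU (d : ℕ) : IsProbabilityMeasure (haarSU d) :=
  ⟨by simpa [haarSU] using Measure.haarMeasure_self (K₀ := (⊤ : TopologicalSpace.PositiveCompacts (SU d)))⟩

/-- The rank-one operator `|ψ⟩⟨ψ|` as a matrix. -/
noncomputable def ketbra {d : ℕ} (ψ : EuclideanSpace ℂ (Fin d)) : Matrix (Fin d) (Fin d) ℂ :=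
  Matrix.of fun i j => ψ i * star (ψ j)

/-- The `k`-fold tensor power `M^{⊗k}` as a matrix in the product basis of `(ℂ^d)^{⊗k}`,
which is indexed by `Fin k → Fin d`. -/
def tensorPow {d : ℕ} (M : Matrix (Fin d) (Fin d) ℂ) (k : ℕ) :
    Matrix (Fin k → Fin d) (Fin k → Fin d) ℂ :=
  Matrix.of fun a b => ∏ i, M (a i) (b i)

/-- The operator `(U |ψ⟩⟨ψ| U†)^{⊗k}`. -/
noncomputable def evolvedReplicas {d : ℕ} (k : ℕ) (ψ : EuclideanSpace ℂ (Fin d)) (U : SU d) :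
    Matrix (Fin k → Fin d) (Fin k → Fin d) ℂ :=
  tensorPow ((U : Matrix (Fin d) (Fin d) ℂ) * ketbra ψ *
    (U : Matrix (Fin d) (Fin d) ℂ).conjTranspose) k

/-- The finite-time average `(1/N) ∑_{n=0}^{N-1} (U(n) |ψ⟩⟨ψ| U(n)†)^{⊗k}`. -/
noncomputable def timeAverage {d : ℕ} (U : ℕ → SU d) (k : ℕ) (ψ : EuclideanSpace ℂ (Fin d))
    (N : ℕ) : Matrix (Fin k → Fin d) (Fin k → Fin d) ℂ :=
  (N : ℂ)⁻¹ • ∑ n ∈ Finset.range N, evolvedReplicas k ψ (U n)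

/-- The `k`-th Haar moment `∫ (U |ψ⟩⟨ψ| U†)^{⊗k} dU` over `SU(d)`, integrated entrywise. -/
noncomputable def haarMoment {d : ℕ} (k : ℕ) (ψ : EuclideanSpace ℂ (Fin d)) :
    Matrix (Fin k → Fin d) (Fin k → Fin d) ℂ :=
  Matrix.of fun a b => ∫ U : SU d, evolvedReplicas k ψ U a b ∂(haarSU d)

theorem continuous_evolvedReplicas {d : ℕ} (k : ℕ) (ψ : EuclideanSpace ℂ (Fin d)) :
    Continuous (evolvedReplicas k ψ) := by
  have hU : Continuous fun U : SU d => (U : Matrix (Fin d) (Fin d) ℂ) := continuous_subtype_val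
  have hM : Continuous fun U : SU d => (U : Matrix (Fin d) (Fin d) ℂ) * ketbra ψ *
      (U : Matrix (Fin d) (Fin d) ℂ).conjTranspose :=
    (hU.matrix_mul continuous_const).matrix_mul hU.matrix_conjTranspose
  refine continuous_matrix fun a b => ?_
  have h : Continuous fun U : SU d => ∏ i, ((U : Matrix (Fin d) (Fin d) ℂ) * ketbra ψ *
      (U : Matrix (Fin d) (Fin d) ℂ).conjTranspose) (a i) (b i) :=
    continuous_finsetProd _ fun i _ => hM.matrix_elem (a i) (b i)
  exact h

/-- The entries in the definition of `haarMoment` are integrable. -/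
theorem integrable_evolvedReplicas {d : ℕ} (k : ℕ) (ψ : EuclideanSpace ℂ (Fin d))
    (a b : Fin k → Fin d) :
    Integrable (fun U : SU d => evolvedReplicas k ψ U a b) (haarSU d) :=
  ((continuous_evolvedReplicas k ψ).matrix_elem a b).integrable_of_hasCompactSupport
    (HasCompactSupport.of_compactSpace _)

/-- Complete Hilbert-space ergodicity of a discrete-time evolution `U`: for every number `k` of
replicas and every initial state `ψ` (a unit vector), the time averages of
`(U(n) |ψ⟩⟨ψ| U(n)†)^{⊗k}` converge to the `k`-th Haar moment. -/
def CompletelyHilbertSpaceErgodic {d : ℕ} (U : ℕ → SU d) : Prop :=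
  ∀ (k : ℕ) (ψ : EuclideanSpace ℂ (Fin d)), ‖ψ‖ = 1 →
    Tendsto (fun N : ℕ => timeAverage U k ψ N) atTop (𝓝 (haarMoment k ψ))

/-- The evolution driven by a word `w`: `U(0) = 1` and `U(n + 1) = A_{w n} U(n)`. The letters of
`w` are numbered from `0`, so `U(n) = A_{w (n-1)} ⋯ A_{w 0}`. -/
def evolution {d : ℕ} (A : Fin 2 → SU d) (w : ℕ → Fin 2) : ℕ → SU d
  | 0 => 1
  | n + 1 => A (w n) * evolution A w n

end CHSE

/-!
The operator `(U|ψ⟩⟨ψ|U†)^{⊗k}` is `ρ(U) M`, where `M = |ψ⟩⟨ψ|^{⊗k}` and `ρ(U)` is conjugation by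
`U^{⊗k}`: a continuous representation of `SU(d)` on a finite-dimensional space, unitary for the
Hilbert–Schmidt inner product (`conjRep`, `norm_conjRep`). It is enough to show that, almost surely,
the averages `S_N` of `ρ(U(n)) v` tend to the Haar average `Q v = ∫ ρ(U) v dU` for all `v`.

Let `p s` be the probability of the letter `s` and `T = ∑ s, p s • ρ (A s)`. Given the first `n`
letters, `ρ(U(n + 1)) v` has conditional expectation `T ρ(U(n)) v`, and the differences between the
two are bounded martingale differences. They obey a strong law of large numbers
(`ae_tendsto_average_noise`), proved from their orthogonality in `L²` along the squares. Telescoping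
gives `(1 - T) S_N → 0`, while `Q S_N = Q v` by right invariance of the Haar measure.

These two relations determine the limit: if `T y = y`, then `y` is a strictly convex combination of
the vectors `ρ (A s) y`, which have the same norm as `y`, so all of them equal `y`
(`eq_of_sum_smul_eq`). By density of the generated subgroup `y` is invariant under `SU(d)`
(`apply_eq_of_dense_closure`), and then `y = Q y`. Hence `(1 - T, Q)` is injective, and in finite
dimension this forces `S_N → Q v` (`tendsto_average_orbit`). The exceptional event is a countable
union, over `k`, the letters and a basis of the operators on `(ℂ^d)^{⊗k}`; it does not depend on
`ψ`.
-/

namespace CHSE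

/-! ### A strong law of large numbers for martingale differences -/

section Noise

theorem dependsOn_sum_range {α 𝕜 E : Type*} [RCLike 𝕜] [NormedAddCommGroup E] [NormedSpace 𝕜 E]
    {ξ : α → ℝ} {Y : ℕ → (ℕ → α) → E}
    (hY : ∀ n, DependsOn (Y n) (Finset.range n : Set ℕ)) (N : ℕ) :
    DependsOn (fun w => ∑ n ∈ Finset.range N, (ξ (w n) : 𝕜) • Y n w)
      (Finset.range N : Set ℕ) := by
  intro w w' h
  refine Finset.sum_congr rfl fun n hn => ?_
  rw [h n hn, hY n fun i hi => h i ?_]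
  simp only [Finset.coe_range, Set.mem_Iio, Finset.mem_range] at *
  omega

/-- For a bounded sequence it suffices to control the averages along the squares, because the number
of terms between consecutive squares is negligible compared with the squares themselves. -/
theorem tendsto_average_of_tendsto_average_sq {𝕜 E : Type*} [RCLike 𝕜] [NormedAddCommGroup E]
    [NormedSpace 𝕜 E] {x : ℕ → E} {C : ℝ} (hC : ∀ n, ‖x n‖ ≤ C)
    (h : Tendsto (fun k : ℕ => ‖∑ n ∈ Finset.range (k ^ 2), x n‖ / (k : ℝ) ^ 2) atTop (𝓝 0)) :
    Tendsto (fun N : ℕ => (N : 𝕜)⁻¹ • ∑ n ∈ Finset.range N, x n) atTop (𝓝 0) := by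
  have hC0 : 0 ≤ C := (norm_nonneg _).trans (hC 0)
  have hb : Tendsto (fun k : ℕ => ‖∑ n ∈ Finset.range (k ^ 2), x n‖ / (k : ℝ) ^ 2
      + 2 * C / k) atTop (𝓝 0) := by
    simpa using h.add (tendsto_const_div_atTop_nhds_zero_nat (2 * C))
  have hsqrt : Tendsto Nat.sqrt atTop atTop :=
    tendsto_atTop.2 fun b => (eventually_ge_atTop (b * b)).mono fun n hn => Nat.le_sqrt.2 hn
  refine squeeze_zero_norm' ?_ (hb.comp hsqrt)
  filter_upwards [eventually_ge_atTop 1] with N hN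
  set k := N.sqrt with hk
  have hk1 : 1 ≤ k := Nat.le_sqrt.2 (by omega)
  have hkN : k ^ 2 ≤ N := Nat.sqrt_le' N
  have hNk : N ≤ k ^ 2 + 2 * k := by have := Nat.lt_succ_sqrt' N; rw [← hk] at this; nlinarith
  have hk0 : (0 : ℝ) < k := by exact_mod_cast hk1
  have hkN' : (k : ℝ) ^ 2 ≤ N := by exact_mod_cast hkN
  have hsplit : ‖∑ n ∈ Finset.range N, x n‖
      ≤ ‖∑ n ∈ Finset.range (k ^ 2), x n‖ + 2 * k * C := by
    rw [← Finset.sum_range_add_sum_Ico _ hkN]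
    refine (norm_add_le _ _).trans ?_
    gcongr
    refine (norm_sum_le_of_le _ fun n _ => hC n).trans ?_
    rw [Finset.sum_const, Nat.card_Ico, nsmul_eq_mul]
    gcongr
    exact_mod_cast (by omega : N - k ^ 2 ≤ 2 * k)
  rw [norm_smul, norm_inv, RCLike.norm_natCast, Function.comp_apply, inv_mul_eq_div]
  calc ‖∑ n ∈ Finset.range N, x n‖ / N
      ≤ (‖∑ n ∈ Finset.range (k ^ 2), x n‖ + 2 * k * C) / (k : ℝ) ^ 2 := by gcongr
    _ = ‖∑ n ∈ Finset.range (k ^ 2), x n‖ / (k : ℝ) ^ 2 + 2 * C / k := by field_simp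

variable {Ω α : Type*} [MeasurableSpace Ω] {P : Measure Ω}
  [Finite α] [MeasurableSpace α] [MeasurableSingletonClass α] {c : ℕ → Ω → α}

/-- The letter of index `n` is uncorrelated with any quantity that is determined by the earlier
letters. -/
theorem integral_mul_of_dependsOn_range (hmeas : ∀ n, Measurable (c n)) (hindep : iIndepFun c P)
    {n : ℕ} (ξ : α → ℝ) {H : (ℕ → α) → ℝ} (hH : DependsOn H (Finset.range n : Set ℕ)) :
    ∫ ω, ξ (c n ω) * H (fun i => c i ω) ∂P
      = (∫ ω, ξ (c n ω) ∂P) * ∫ ω, H (fun i => c i ω) ∂P := by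
  obtain ⟨g, rfl⟩ := dependsOn_iff_exists_comp.1 hH
  have h := hindep.indepFun_finset {n} (Finset.range n) (by simp) hmeas
  have h' := h.comp (φ := fun u => ξ (u ⟨n, by simp⟩)) (ψ := fun u => g u)
    (measurable_of_finite _) (measurable_of_finite _)
  have hu : Measurable fun ω => (Finset.range n : Set ℕ).domRestrict fun i => c i ω :=
    measurable_pi_lambda _ fun i => hmeas i
  exact h'.integral_fun_mul_eq_mul_integral
    ((measurable_of_finite ξ).comp (hmeas n)).aestronglyMeasurable
    ((measurable_of_finite g).comp hu).aestronglyMeasurable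

variable [IsProbabilityMeasure P]

theorem integrable_of_dependsOn_range (hmeas : ∀ n, Measurable (c n)) {n : ℕ}
    {H : (ℕ → α) → ℝ} (hH : DependsOn H (Finset.range n : Set ℕ)) :
    Integrable (fun ω => H fun i => c i ω) P := by
  obtain ⟨g, rfl⟩ := dependsOn_iff_exists_comp.1 hH
  have hu : Measurable fun ω => (Finset.range n : Set ℕ).domRestrict fun i => c i ω :=
    measurable_pi_lambda _ fun i => hmeas i
  have : IsProbabilityMeasure
      (P.map fun ω => (Finset.range n : Set ℕ).domRestrict fun i => c i ω) :=
    Measure.isProbabilityMeasure_map hu.aemeasurable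
  exact (Integrable.of_finite (f := g)).comp_measurable hu

variable {𝕜 E : Type*} [RCLike 𝕜] [NormedAddCommGroup E] [InnerProductSpace 𝕜 E]

/-- The increments are martingale differences, hence orthogonal in `L²`: the second moment of their
sum grows at most linearly. -/
theorem integral_norm_sq_sum_le (hmeas : ∀ n, Measurable (c n)) (hindep : iIndepFun c P)
    {ξ : α → ℝ} (hξ : ∀ n, ∫ ω, ξ (c n ω) ∂P = 0) {Y : ℕ → (ℕ → α) → E}
    (hY : ∀ n, DependsOn (Y n) (Finset.range n : Set ℕ)) {C : ℝ}
    (hC : ∀ n w, ‖(ξ (w n) : 𝕜) • Y n w‖ ≤ C) (N : ℕ) :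
    ∫ ω, ‖∑ n ∈ Finset.range N, (ξ (c n ω) : 𝕜) • Y n (fun i => c i ω)‖ ^ 2 ∂P ≤ N * C ^ 2 := by
  set S : ℕ → (ℕ → α) → E := fun N w => ∑ n ∈ Finset.range N, (ξ (w n) : 𝕜) • Y n w with hSdef
  have hS : ∀ N, DependsOn (S N) (Finset.range N : Set ℕ) := dependsOn_sum_range hY
  have hint : ∀ n, Integrable (fun ω => ‖S n fun i => c i ω‖ ^ 2) P := fun n =>
    integrable_of_dependsOn_range (n := n) (H := fun w => ‖S n w‖ ^ 2) hmeas
      fun w w' h => by simp only [hS n h]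
  change ∫ ω, ‖S N fun i => c i ω‖ ^ 2 ∂P ≤ N * C ^ 2
  induction N with
  | zero => simp [hSdef]
  | succ N ih =>
    let H : (ℕ → α) → ℝ := fun w => RCLike.re (inner 𝕜 (S N w) (Y N w))
    have hH : DependsOn H (Finset.range N : Set ℕ) := fun w w' h => by
      simp only [H, hS N h, hY N h]
    have hcross : ∫ ω, ξ (c N ω) * H (fun i => c i ω) ∂P = 0 := by
      rw [integral_mul_of_dependsOn_range hmeas hindep ξ hH, hξ, zero_mul]
    have hcint : Integrable (fun ω => ξ (c N ω) * H (fun i => c i ω)) P :=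
      integrable_of_dependsOn_range (n := N + 1) (H := fun w => ξ (w N) * H w) hmeas
        fun w w' h => by
          have h1 : w N = w' N := h N (by simp)
          have h2 : H w = H w' := hH fun i hi => h i (by simp at *; omega)
          simp only [h1, h2]
    have hle : ∀ ω, ‖S (N + 1) fun i => c i ω‖ ^ 2
        ≤ ‖S N fun i => c i ω‖ ^ 2 + 2 * (ξ (c N ω) * H (fun i => c i ω)) + C ^ 2 := by
      intro ω
      simp only [hSdef, Finset.sum_range_succ]
      -- The cross term of the square is `2 * ξ (c N) * H`, of mean zero.
      rw [norm_add_sq (𝕜 := 𝕜), inner_smul_right, RCLike.re_ofReal_mul]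
      have := hC N fun i => c i ω
      gcongr
    have hsum : Integrable (fun ω => ‖S N fun i => c i ω‖ ^ 2
        + 2 * (ξ (c N ω) * H (fun i => c i ω))) P := (hint N).add (hcint.const_mul 2)
    calc ∫ ω, ‖S (N + 1) fun i => c i ω‖ ^ 2 ∂P
        ≤ ∫ ω, (‖S N fun i => c i ω‖ ^ 2 + 2 * (ξ (c N ω) * H (fun i => c i ω)) + C ^ 2) ∂P :=
          integral_mono (hint _) (hsum.add (integrable_const _)) hle
      _ = ∫ ω, ‖S N fun i => c i ω‖ ^ 2 ∂P + C ^ 2 := by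
          rw [integral_add hsum (integrable_const _),
            integral_add (hint N) (hcint.const_mul 2), integral_const_mul, hcross]
          simp
      _ ≤ ((N + 1 : ℕ) : ℝ) * C ^ 2 := by push_cast; linarith

/-- A strong law of large numbers for the bounded martingale differences `ξ (c n) • Y n`, where `Y n`
is determined by the letters before `n`. The second moments of the averages along the squares are
summable. -/
theorem ae_tendsto_average_noise (hmeas : ∀ n, Measurable (c n)) (hindep : iIndepFun c P)
    {ξ : α → ℝ} (hξ : ∀ n, ∫ ω, ξ (c n ω) ∂P = 0) {Y : ℕ → (ℕ → α) → E}
    (hY : ∀ n, DependsOn (Y n) (Finset.range n : Set ℕ)) {C : ℝ}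
    (hC : ∀ n w, ‖(ξ (w n) : 𝕜) • Y n w‖ ≤ C) :
    ∀ᵐ ω ∂P, Tendsto (fun N : ℕ => (N : 𝕜)⁻¹ •
      ∑ n ∈ Finset.range N, (ξ (c n ω) : 𝕜) • Y n (fun i => c i ω)) atTop (𝓝 0) := by
  have hsecond := integral_norm_sq_sum_le hmeas hindep hξ hY hC
  set S : ℕ → (ℕ → α) → E := fun N w => ∑ n ∈ Finset.range N, (ξ (w n) : 𝕜) • Y n w with hSdef
  have hS : ∀ N, DependsOn (S N) (Finset.range N : Set ℕ) := dependsOn_sum_range hY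
  set Z : ℕ → Ω → ℝ := fun k ω => (‖S (k ^ 2) fun i => c i ω‖ / (k : ℝ) ^ 2) ^ 2 with hZ
  have hZint : ∀ k, Integrable (Z k) P := fun k =>
    integrable_of_dependsOn_range (n := k ^ 2)
      (H := fun w => (‖S (k ^ 2) w‖ / (k : ℝ) ^ 2) ^ 2) hmeas
      fun w w' h => by simp only [hS _ h]
  have hZle : ∀ k, ∫ ω, Z k ω ∂P ≤ C ^ 2 * (1 / (k : ℝ) ^ 2) := by
    intro k
    rcases Nat.eq_zero_or_pos k with rfl | hk
    -- Both sides vanish at `k = 0`, where the divisions by zero give zero.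
    · simp [hZ]
    have hk0 : (0 : ℝ) < k := by exact_mod_cast hk
    simp only [hZ, div_pow, integral_div]
    calc _ ≤ ((k ^ 2 : ℕ) : ℝ) * C ^ 2 / ((k : ℝ) ^ 2) ^ 2 := by gcongr; exact hsecond (k ^ 2)
      _ = _ := by push_cast; field_simp
  have hsum : ∑' k, ∫⁻ ω, ENNReal.ofReal (Z k ω) ∂P ≠ ⊤ := by
    have hs : Summable fun k : ℕ => C ^ 2 * (1 / (k : ℝ) ^ 2) :=
      (Real.summable_one_div_nat_pow.2 one_lt_two).mul_left _
    refine ne_top_of_le_ne_top hs.tsum_ofReal_ne_top (ENNReal.tsum_le_tsum fun k => ?_)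
    rw [← ofReal_integral_eq_lintegral_ofReal (hZint k) (ae_of_all _ fun ω => sq_nonneg _)]
    exact ENNReal.ofReal_le_ofReal (hZle k)
  have hmZ : ∀ k, AEMeasurable (fun ω => ENNReal.ofReal (Z k ω)) P :=
    fun k => (hZint k).aemeasurable.ennreal_ofReal
  -- Almost surely the squared averages along `k ↦ k ^ 2` have a finite sum, so they tend to zero.
  rw [← lintegral_tsum hmZ] at hsum
  filter_upwards [ae_lt_top' (AEMeasurable.tsum hmZ) hsum] with ω hω
  refine tendsto_average_of_tendsto_average_sq (C := C) (fun n => hC n fun i => c i ω) ?_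
  have h0 := ENNReal.tendsto_atTop_zero_of_tsum_ne_top hω.ne
  have h1 := (Real.continuous_sqrt.tendsto 0).comp
    ((ENNReal.tendsto_toReal ENNReal.zero_ne_top).comp h0)
  rw [Real.sqrt_zero] at h1
  refine h1.congr fun k => ?_
  simp only [Function.comp_apply, hZ]
  rw [ENNReal.toReal_ofReal (sq_nonneg _), Real.sqrt_sq (by positivity)]

end Noise

/-! ### Orbit averages in unitary representations of compact groups -/

section Representation

variable {V : Type*} [NormedAddCommGroup V] [InnerProductSpace ℂ V]

/-- A strictly convex combination of vectors of norm `‖y‖` equals `y` only if all of them equal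
`y`. -/
theorem eq_of_sum_smul_eq {ι : Type*} [Fintype ι] {p : ι → ℝ} (hp : ∀ s, 0 < p s)
    (hp1 : ∑ s, p s = 1) {u : ι → V} {y : V} (hu : ∀ s, ‖u s‖ = ‖y‖)
    (h : ∑ s, (p s : ℂ) • u s = y) (s : ι) : u s = y := by
  have hsum : ∑ s, p s * ‖u s - y‖ ^ 2 = 0 := by
    have h1 : ∀ s, p s * ‖u s - y‖ ^ 2
        = 2 * ‖y‖ ^ 2 * p s - 2 * RCLike.re (inner ℂ y ((p s : ℂ) • u s)) := by
      intro s
      rw [norm_sub_sq (𝕜 := ℂ), hu, inner_smul_right, inner_re_symm]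
      have : RCLike.re ((p s : ℂ) * inner ℂ y (u s)) = p s * RCLike.re (inner ℂ y (u s)) :=
        RCLike.re_ofReal_mul _ _
      rw [this]
      ring
    simp only [h1, Finset.sum_sub_distrib, ← Finset.mul_sum, hp1]
    rw [← map_sum, ← inner_sum, h, inner_self_eq_norm_sq]
    ring
  have h0 := (Finset.sum_eq_zero_iff_of_nonneg fun s _ =>
    mul_nonneg (hp s).le (sq_nonneg _)).1 hsum s (Finset.mem_univ s)
  simpa [(hp s).ne', sub_eq_zero] using h0

variable {G : Type*} [Group G] [TopologicalSpace G] {ρ : Representation ℂ G V}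

/-- The stabiliser of a vector is a closed subgroup, so it is everything once it contains topological
generators. -/
theorem apply_eq_of_dense_closure {y : V} (hcont : Continuous fun g => ρ g y)
    {S : Set G} (hS : Dense (Subgroup.closure S : Set G)) (hy : ∀ a ∈ S, ρ a y = y) (g : G) :
    ρ g y = y := by
  have hcl : IsClosed {g | ρ g y = y} := isClosed_eq hcont continuous_const
  have hsub : (Subgroup.closure S : Set G) ⊆ {g | ρ g y = y} := by
    intro g hg
    induction hg using Subgroup.closure_induction with
    | mem a ha => exact hy a ha
    | one => simp
    | mul a b _ _ ha hb =>
      simp only [Set.mem_ofPred_eq, map_mul, Module.End.mul_apply] at *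
      rw [hb, ha]
    | inv a _ ha =>
      simp only [Set.mem_ofPred_eq] at *
      conv_lhs => rw [← ha]
      rw [← Module.End.mul_apply, ← map_mul, inv_mul_cancel, map_one, Module.End.one_apply]
  exact (hcl.closure_subset_iff.2 hsub) (hS.closure_eq ▸ Set.mem_univ g)

variable [CompactSpace G] [MeasurableSpace G] [BorelSpace G]
  (μ : Measure G) [IsProbabilityMeasure μ]

theorem integrable_orbit {y : V} (hcont : Continuous fun g => ρ g y) :
    Integrable (fun g => ρ g y) μ :=
  hcont.integrable_of_hasCompactSupport (HasCompactSupport.of_compactSpace _)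

/-- The averaging operator `y ↦ ∫ ρ g y dμ(g)` of a continuous representation. -/
noncomputable def averageMap (ρ : Representation ℂ G V)
    (hcont : ∀ y, Continuous fun g => ρ g y) : V →ₗ[ℂ] V where
  toFun y := ∫ g, ρ g y ∂μ
  map_add' y z := by
    simp only [map_add]
    exact integral_add (integrable_orbit μ (hcont y)) (integrable_orbit μ (hcont z))
  map_smul' a y := by
    simp only [map_smul, RingHom.id_apply]
    exact integral_smul a _

variable (hcont : ∀ y, Continuous fun g => ρ g y)

theorem averageMap_of_fixed [FiniteDimensional ℂ V] {y : V} (hy : ∀ g, ρ g y = y) :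
    averageMap μ ρ hcont y = y := by
  have : CompleteSpace V := FiniteDimensional.complete ℂ V
  simp [averageMap, hy]

variable [ContinuousMul G]

theorem averageMap_apply_apply [μ.IsMulRightInvariant] (a : G) (v : V) :
    averageMap μ ρ hcont (ρ a v) = averageMap μ ρ hcont v := by
  simp only [averageMap, LinearMap.coe_mk, AddHom.coe_mk]
  simp only [← Module.End.mul_apply, ← map_mul]
  exact integral_mul_right_eq_self (fun g => ρ g v) a

theorem apply_averageMap [FiniteDimensional ℂ V] [μ.IsMulLeftInvariant] (a : G) (v : V) :
    ρ a (averageMap μ ρ hcont v) = averageMap μ ρ hcont v := by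
  simp only [averageMap, LinearMap.coe_mk, AddHom.coe_mk]
  have h := ((ρ a).toContinuousLinearMap).integral_comp_comm (integrable_orbit μ (hcont v))
  simp only [LinearMap.coe_toContinuousLinearMap'] at h
  rw [← h]
  simp only [← Module.End.mul_apply, ← map_mul]
  exact integral_mul_left_eq_self (fun g => ρ g v) a

/-- A deterministic criterion for the equidistribution of the orbit of `v` along the walk `X` driven
by the word `w`: if the fluctuations of every letter `s` around its weight `p s`, weighted by the
orbit, average out, then the orbit averages tend to the Haar average. With `T = ∑ s, p s • ρ (A s)`
the hypothesis gives `(1 - T) S_N → 0` for the averages `S_N`, whereas the Haar average of `S_N` is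
constant; these two conditions determine the limit, as every fixed vector of `T` is invariant. -/
theorem tendsto_average_orbit [FiniteDimensional ℂ V] [μ.IsMulLeftInvariant] [μ.IsMulRightInvariant]
    (hiso : ∀ g y, ‖ρ g y‖ = ‖y‖) {ι : Type*} [Fintype ι] [DecidableEq ι] {A : ι → G}
    (hA : Dense (Subgroup.closure (Set.range A) : Set G))
    {p : ι → ℝ} (hp : ∀ s, 0 < p s) (hp1 : ∑ s, p s = 1)
    {w : ℕ → ι} {X : ℕ → G} (hX : ∀ n, X (n + 1) = A (w n) * X n) (v : V)
    (hnoise : ∀ s, Tendsto (fun N : ℕ => (N : ℂ)⁻¹ • ∑ n ∈ Finset.range N,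
      (((if w n = s then 1 else 0) - p s : ℝ) : ℂ) • ρ (X n) v) atTop (𝓝 0)) :
    Tendsto (fun N : ℕ => (N : ℂ)⁻¹ • ∑ n ∈ Finset.range N, ρ (X n) v) atTop
      (𝓝 (averageMap μ ρ hcont (ρ (X 0) v))) := by
  set Q := averageMap μ ρ hcont with hQ
  let T : V →ₗ[ℂ] V := ∑ s, (p s : ℂ) • ρ (A s)
  have hT : ∀ y, T y = ∑ s, (p s : ℂ) • ρ (A s) y := fun y => by simp [T]
  let L : V →ₗ[ℂ] V × V := (LinearMap.id - T).prod Q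
  have hker : LinearMap.ker L = ⊥ := by
    refine LinearMap.ker_eq_bot'.2 fun y hy => ?_
    simp only [L, LinearMap.prod_apply, Function.prod, Prod.mk_eq_zero, LinearMap.sub_apply,
      LinearMap.id_apply, sub_eq_zero] at hy
    have hfix := eq_of_sum_smul_eq hp hp1 (fun s => hiso (A s) y) ((hT y).symm.trans hy.1.symm)
    rw [← hy.2]
    exact (averageMap_of_fixed μ hcont (apply_eq_of_dense_closure (hcont y) hA
      (by rintro _ ⟨s, rfl⟩; exact hfix s))).symm
  -- In finite dimension an injective linear map is an embedding, so convergence may be tested after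
  -- applying `L = (1 - T, Q)`.
  rw [(LinearMap.isClosedEmbedding_of_injective hker).isEmbedding.tendsto_nhds_iff]
  have hL : L (Q (ρ (X 0) v)) = (0, Q (ρ (X 0) v)) := by
    have h1 : T (Q (ρ (X 0) v)) = Q (ρ (X 0) v) := by
      rw [hT]
      simp only [hQ, apply_averageMap, ← Finset.sum_smul]
      rw [← Complex.ofReal_sum, hp1, Complex.ofReal_one, one_smul]
    have h2 : Q (Q (ρ (X 0) v)) = Q (ρ (X 0) v) :=
      averageMap_of_fixed μ hcont fun g => apply_averageMap μ hcont g _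
    simp [L, h1, h2]
  rw [hL]
  set y : ℕ → V := fun n => ρ (X n) v with hy
  have hynorm : ∀ n, ‖y n‖ = ‖v‖ := fun n => hiso _ _
  have hystep : ∀ n, y (n + 1) = ρ (A (w n)) (y n) := fun n => by
    simp only [hy, hX, map_mul, Module.End.mul_apply]
  have hQy : ∀ n, Q (y n) = Q (ρ (X 0) v) := fun n => by
    simp only [hy, hQ, averageMap_apply_apply]
  refine Tendsto.prodMk_nhds (f := atTop) ?_ ?_
  · have hstep : ∀ n, y n - T (y n) = (y n - y (n + 1))
        + ∑ s, ρ (A s) ((((if w n = s then 1 else 0) - p s : ℝ) : ℂ) • y n) := by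
      intro n
      have h1 : ∑ s, (((if w n = s then 1 else 0 : ℝ)) : ℂ) • ρ (A s) (y n) = y (n + 1) := by
        rw [hystep, Finset.sum_eq_single (w n)]
        · simp
        · intro s _ hs
          simp [hs.symm]
        · simp
      simp only [Complex.ofReal_sub, sub_smul, map_sub, map_smul, Finset.sum_sub_distrib, h1,
        ← hT]
      abel
    -- The differences `y n - y (n + 1)` telescope, which leaves a boundary term and the noise.
    have hdecomp : ∀ N : ℕ, (LinearMap.id - T : V →ₗ[ℂ] V) ((N : ℂ)⁻¹ • ∑ n ∈ Finset.range N, y n)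
        = (N : ℂ)⁻¹ • (y 0 - y N) + ∑ s, ρ (A s) ((N : ℂ)⁻¹ • ∑ n ∈ Finset.range N,
          (((if w n = s then 1 else 0) - p s : ℝ) : ℂ) • y n) := by
      intro N
      rw [map_smul, map_sum]
      simp only [LinearMap.sub_apply, LinearMap.id_apply, hstep, Finset.sum_add_distrib,
        Finset.sum_range_sub', smul_add]
      rw [Finset.sum_comm, Finset.smul_sum]
      simp only [map_smul (ρ (A _)) (_ : ℂ), map_sum]
    have hbdry : Tendsto (fun N : ℕ => (N : ℂ)⁻¹ • (y 0 - y N)) atTop (𝓝 0) := by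
      refine squeeze_zero_norm (fun N => ?_)
        (tendsto_const_div_atTop_nhds_zero_nat (‖v‖ + ‖v‖))
      rw [norm_smul, norm_inv, Complex.norm_natCast, inv_mul_eq_div]
      gcongr
      exact (norm_sub_le _ _).trans (by rw [hynorm, hynorm])
    have hmart := tendsto_finsetSum Finset.univ fun s _ =>
      ((ρ (A s)).continuous_of_finiteDimensional.tendsto 0).comp (hnoise s)
    simp only [map_zero, Finset.sum_const_zero] at hmart
    have := hbdry.add hmart
    rw [add_zero] at this
    exact this.congr fun N => (hdecomp N).symm
  · refine tendsto_const_nhds.congr' ?_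
    filter_upwards [eventually_ge_atTop 1] with N hN
    have hN0 : (N : ℂ) ≠ 0 := by exact_mod_cast (by omega : N ≠ 0)
    change _ = Q ((N : ℂ)⁻¹ • ∑ n ∈ Finset.range N, y n)
    rw [map_smul, map_sum, Finset.sum_congr rfl fun n _ => hQy n, Finset.sum_const,
      Finset.card_range, ← Nat.cast_smul_eq_nsmul ℂ, smul_smul, inv_mul_cancel₀ hN0, one_smul]

end Representation

/-- Compact groups are unimodular: right translates of the Haar measure are again normalised Haar
measures, which are unique. -/
theorem isMulRightInvariant_of_isProbabilityMeasure {G : Type*} [Group G] [TopologicalSpace G]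
    [IsTopologicalGroup G] [CompactSpace G] [MeasurableSpace G] [BorelSpace G] (μ : Measure G)
    [μ.IsHaarMeasure] [IsProbabilityMeasure μ] : μ.IsMulRightInvariant where
  map_mul_right_eq_self g := by
    have : IsProbabilityMeasure (μ.map (· * g)) :=
      Measure.isProbabilityMeasure_map (measurable_mul_const g).aemeasurable
    exact Measure.isHaarMeasure_eq_of_isProbabilityMeasure _ _

theorem tendsto_apply_of_basis {ι V : Type*} [Finite ι] [NormedAddCommGroup V] [NormedSpace ℂ V]
    (b : Module.Basis ι ℂ V) {F : ℕ → V →ₗ[ℂ] V} {L : V →ₗ[ℂ] V}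
    (h : ∀ j, Tendsto (fun N => F N (b j)) atTop (𝓝 (L (b j)))) (v : V) :
    Tendsto (fun N => F N v) atTop (𝓝 (L v)) := by
  have := Fintype.ofFinite ι
  have hrepr : ∀ T : V →ₗ[ℂ] V, T v = ∑ j, b.repr v j • T (b j) := fun T => by
    conv_lhs => rw [← b.sum_repr v, map_sum]
    simp only [map_smul]
  simp only [hrepr]
  exact tendsto_finsetSum _ fun j _ => (h j).const_smul _

/-! ### The conjugation representation on replicas -/

theorem tensorPow_mul {d : ℕ} (M N : Matrix (Fin d) (Fin d) ℂ) (k : ℕ) :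
    tensorPow (M * N) k = tensorPow M k * tensorPow N k := by
  ext a b
  simp only [tensorPow, Matrix.of_apply, Matrix.mul_apply, Finset.prod_univ_sum,
    Fintype.piFinset_univ, Finset.prod_mul_distrib]

theorem tensorPow_one {d : ℕ} (k : ℕ) :
    tensorPow (1 : Matrix (Fin d) (Fin d) ℂ) k = 1 := by
  ext a b
  simp only [tensorPow, Matrix.of_apply, Matrix.one_apply, Finset.prod_boole, funext_iff,
    Finset.mem_univ, true_implies]

theorem conjTranspose_tensorPow {d : ℕ} (M : Matrix (Fin d) (Fin d) ℂ) (k : ℕ) :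
    (tensorPow M k).conjTranspose = tensorPow M.conjTranspose k := by
  ext a b
  simp [tensorPow, Matrix.conjTranspose_apply]

/-- The Hilbert space of operators on `(ℂ^d)^{⊗k}`, with the Hilbert–Schmidt inner product; its
vectors are the families of matrix entries. -/
abbrev OperatorSpace (d k : ℕ) : Type :=
  EuclideanSpace ℂ ((Fin k → Fin d) × (Fin k → Fin d))

/-- The identification of matrices with vectors of the Hilbert–Schmidt space. -/
def vecEquiv (d k : ℕ) :
    Matrix (Fin k → Fin d) (Fin k → Fin d) ℂ ≃ₗ[ℂ] OperatorSpace d k :=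
  (LinearEquiv.curry ℂ ℂ (Fin k → Fin d) (Fin k → Fin d)).symm ≪≫ₗ
    (WithLp.linearEquiv 2 ℂ ((Fin k → Fin d) × (Fin k → Fin d) → ℂ)).symm

theorem vecEquiv_apply {d k : ℕ} (M : Matrix (Fin k → Fin d) (Fin k → Fin d) ℂ) (p) :
    vecEquiv d k M p = M p.1 p.2 := rfl

theorem norm_vecEquiv_sq {d k : ℕ} (M : Matrix (Fin k → Fin d) (Fin k → Fin d) ℂ) :
    ((‖vecEquiv d k M‖ ^ 2 : ℝ) : ℂ) = (M * M.conjTranspose).trace := by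
  rw [EuclideanSpace.norm_sq_eq, Fintype.sum_prod_type]
  simp only [Matrix.trace, Matrix.diag, Matrix.mul_apply, Matrix.conjTranspose_apply,
    vecEquiv_apply]
  push_cast
  refine Finset.sum_congr rfl fun a _ => Finset.sum_congr rfl fun b _ => ?_
  exact (Complex.mul_conj' _).symm

/-- The representation `M ↦ U^{⊗k} M (U^{⊗k})†` of `SU(d)` on operators on `(ℂ^d)^{⊗k}`. -/
def conjRep (d k : ℕ) : Representation ℂ (SU d) (OperatorSpace d k) where
  toFun U := (vecEquiv d k).conj
    (LinearMap.mulLeft ℂ (tensorPow (U : Matrix (Fin d) (Fin d) ℂ) k) ∘ₗ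
      LinearMap.mulRight ℂ (tensorPow (U : Matrix (Fin d) (Fin d) ℂ) k).conjTranspose)
  map_one' := by
    ext1 y
    simp [LinearEquiv.conj_apply, tensorPow_one]
  map_mul' U W := by
    ext1 y
    simp [LinearEquiv.conj_apply, tensorPow_mul, mul_assoc]

theorem conjRep_vecEquiv {d k : ℕ} (U : SU d) (M : Matrix (Fin k → Fin d) (Fin k → Fin d) ℂ) :
    conjRep d k U (vecEquiv d k M) = vecEquiv d k (tensorPow (U : Matrix (Fin d) (Fin d) ℂ) k * M *
      (tensorPow (U : Matrix (Fin d) (Fin d) ℂ) k).conjTranspose) := by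
  simp [conjRep, LinearEquiv.conj_apply, mul_assoc]

theorem conjRep_vecEquiv_tensorPow {d k : ℕ} (U : SU d) (ψ : EuclideanSpace ℂ (Fin d)) :
    conjRep d k U (vecEquiv d k (tensorPow (ketbra ψ) k))
      = vecEquiv d k (evolvedReplicas k ψ U) := by
  rw [conjRep_vecEquiv, evolvedReplicas, tensorPow_mul, tensorPow_mul, conjTranspose_tensorPow]

theorem tensorPow_conjTranspose_mul_self {d : ℕ} (k : ℕ) (U : SU d) :
    (tensorPow (U : Matrix (Fin d) (Fin d) ℂ) k).conjTranspose *
      tensorPow (U : Matrix (Fin d) (Fin d) ℂ) k = 1 := by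
  have hU : (U : Matrix (Fin d) (Fin d) ℂ).conjTranspose * U = 1 :=
    Matrix.mem_unitaryGroup_iff'.1 (Matrix.specialUnitaryGroup_le_unitaryGroup U.2)
  rw [conjTranspose_tensorPow, ← tensorPow_mul, hU, tensorPow_one]

theorem norm_conjRep {d k : ℕ} (U : SU d) (y : OperatorSpace d k) : ‖conjRep d k U y‖ = ‖y‖ := by
  obtain ⟨M, rfl⟩ := (vecEquiv d k).surjective y
  rw [← sq_eq_sq₀ (norm_nonneg _) (norm_nonneg _), ← Complex.ofReal_inj, conjRep_vecEquiv,
    norm_vecEquiv_sq, norm_vecEquiv_sq]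
  set T := tensorPow (U : Matrix (Fin d) (Fin d) ℂ) k
  have hT : T.conjTranspose * T = 1 := tensorPow_conjTranspose_mul_self k U
  calc (T * M * T.conjTranspose * (T * M * T.conjTranspose).conjTranspose).trace
      = (T * (M * (T.conjTranspose * T) * M.conjTranspose * T.conjTranspose)).trace := by
        simp only [Matrix.conjTranspose_mul, Matrix.conjTranspose_conjTranspose, Matrix.mul_assoc]
    _ = (M * M.conjTranspose).trace := by
        rw [Matrix.trace_mul_comm, hT, Matrix.mul_one, Matrix.mul_assoc, hT, Matrix.mul_one]

theorem continuous_conjRep {d k : ℕ} (y : OperatorSpace d k) :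
    Continuous fun U => conjRep d k U y := by
  obtain ⟨M, rfl⟩ := (vecEquiv d k).surjective y
  simp only [conjRep_vecEquiv]
  have hT : Continuous fun U : SU d => tensorPow (U : Matrix (Fin d) (Fin d) ℂ) k :=
    continuous_matrix fun a b => by
      simp only [tensorPow, Matrix.of_apply]
      exact continuous_finsetProd _ fun i _ => continuous_subtype_val.matrix_elem (a i) (b i)
  have hM := (hT.matrix_mul (continuous_const (y := M))).matrix_mul hT.matrix_conjTranspose
  exact (PiLp.continuous_toLp 2 _).comp (continuous_pi fun p => hM.matrix_elem p.1 p.2)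

/-! ### Random walks on `SU(d)` -/

theorem evolution_dependsOn {d : ℕ} (A : Fin 2 → SU d) (n : ℕ) :
    DependsOn (fun w => evolution A w n) (Finset.range n : Set ℕ) := by
  induction n with
  | zero => intro w w' _; rfl
  | succ n ih =>
    intro w w' h
    have h1 : evolution A w n = evolution A w' n := ih fun i hi => h i (by simp at *; omega)
    simp only [evolution, h1, h n (by simp)]

/-- The hypothesis of `tendsto_average_orbit` holds almost surely for the random walk. -/
theorem ae_tendsto_average_centred_letter {d : ℕ} (A : Fin 2 → SU d)
    {Ω : Type*} [MeasurableSpace Ω] (P : Measure Ω) [IsProbabilityMeasure P]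
    (c : ℕ → Ω → Fin 2) (hmeas : ∀ n, Measurable (c n)) (hindep : iIndepFun c P)
    (hident : ∀ n, IdentDistrib (c n) (c 0) P P) {k : ℕ} (s : Fin 2) (v : OperatorSpace d k) :
    ∀ᵐ ω ∂P, Tendsto (fun N : ℕ => (N : ℂ)⁻¹ • ∑ n ∈ Finset.range N,
      (((if c n ω = s then 1 else 0) - P.real (c 0 ⁻¹' {s}) : ℝ) : ℂ) •
        conjRep d k (evolution A (fun i => c i ω) n) v) atTop (𝓝 0) := by
  refine ae_tendsto_average_noise (𝕜 := ℂ) (c := c) hmeas hindep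
    (ξ := fun t => (if t = s then 1 else 0) - P.real (c 0 ⁻¹' {s}))
    (Y := fun n w => conjRep d k (evolution A w n) v) (C := 1 * ‖v‖) ?_ ?_ ?_
  · intro n
    have h1 : ∫ ω, ((if c n ω = s then 1 else 0) : ℝ) ∂P = P.real (c 0 ⁻¹' {s}) := by
      have : (fun ω => ((if c n ω = s then 1 else 0) : ℝ))
          = (c n ⁻¹' {s}).indicator fun _ => 1 := by
        funext ω
        by_cases h : c n ω = s <;> simp [h]
      rw [this, integral_indicator_const _ (hmeas n (measurableSet_singleton s)), smul_eq_mul,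
        mul_one, measureReal_def, (hident n).measure_preimage_eq (measurableSet_singleton s),
        measureReal_def]
    have hint : Integrable (fun ω => ((if c n ω = s then 1 else 0) : ℝ)) P :=
      integrable_of_dependsOn_range (n := n + 1) (H := fun w => if w n = s then 1 else 0) hmeas
        fun w w' h => by
          have h1 : w n = w' n := h n (by simp)
          simp only [h1]
    rw [integral_sub hint (integrable_const _), h1]
    simp
  · intro n w w' h
    have h1 : evolution A w n = evolution A w' n := evolution_dependsOn A n h
    simp only [h1]
  · intro n w
    rw [norm_smul, norm_conjRep]
    gcongr
    rw [RCLike.norm_ofReal, abs_le]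
    have h0 : 0 ≤ P.real (c 0 ⁻¹' {s}) := measureReal_nonneg
    have h1 : P.real (c 0 ⁻¹' {s}) ≤ 1 := measureReal_le_one
    split_ifs <;> constructor <;> linarith

end CHSE

open CHSE

theorem theoremS1 (d : ℕ) (A : Fin 2 → CHSE.SU d)
    (hA : Dense (Subgroup.closure {A 0, A 1} : Set (CHSE.SU d)))
    {Ω : Type*} [MeasurableSpace Ω] (P : Measure Ω) [IsProbabilityMeasure P]
    (c : ℕ → Ω → Fin 2) (hmeas : ∀ n, Measurable (c n))
    (hindep : iIndepFun c P)
    (hident : ∀ n, IdentDistrib (c n) (c 0) P P)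
    (hsupp : ∀ s : Fin 2, 0 < P (c 0 ⁻¹' {s})) :
    ∀ᵐ ω ∂P, CHSE.CompletelyHilbertSpaceErgodic (CHSE.evolution A fun n => c n ω) := by
  have hrange : Set.range A = {A 0, A 1} := by
    ext g; simp [Fin.exists_fin_two, eq_comm]
  have hp1 : ∑ s, P.real (c 0 ⁻¹' {s}) = 1 := by
    rw [sum_measureReal_preimage_singleton _ fun s _ => hmeas 0 (measurableSet_singleton s)]
    simp
  have hp : ∀ s, 0 < P.real (c 0 ⁻¹' {s}) := fun s =>
    ENNReal.toReal_pos (hsupp s).ne' (measure_ne_top _ _)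
  have hnoise : ∀ᵐ ω ∂P, ∀ (k : ℕ) (s : Fin 2) (j), Tendsto (fun N : ℕ => (N : ℂ)⁻¹ •
      ∑ n ∈ Finset.range N, (((if c n ω = s then 1 else 0) - P.real (c 0 ⁻¹' {s}) : ℝ) : ℂ) •
        conjRep d k (evolution A (fun i => c i ω) n)
          (Module.finBasis ℂ (OperatorSpace d k) j)) atTop (𝓝 0) :=
    ae_all_iff.2 fun k => ae_all_iff.2 fun s => ae_all_iff.2 fun j =>
      ae_tendsto_average_centred_letter A P c hmeas hindep hident s _
  have hright := isMulRightInvariant_of_isProbabilityMeasure (haarSU d)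
  -- Countably many conditions have been imposed, none of them involving `ψ`; all vectors are
  -- reached from the basis by linearity.
  filter_upwards [hnoise] with ω hω k ψ _
  have hbasis : ∀ j, Tendsto (fun N : ℕ => (N : ℂ)⁻¹ • ∑ n ∈ Finset.range N,
      conjRep d k (evolution A (fun i => c i ω) n) (Module.finBasis ℂ (OperatorSpace d k) j)) atTop
      (𝓝 (averageMap (haarSU d) (conjRep d k) continuous_conjRep
        (Module.finBasis ℂ (OperatorSpace d k) j))) := fun j => by
    simpa [evolution] using tendsto_average_orbit (haarSU d) continuous_conjRep norm_conjRep
      (by rwa [hrange]) hp hp1 (w := fun n => c n ω) (X := evolution A fun n => c n ω)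
      (fun _ => rfl) _ fun s => hω k s j
  have hall : ∀ v : OperatorSpace d k, Tendsto (fun N : ℕ => (N : ℂ)⁻¹ • ∑ n ∈ Finset.range N,
      conjRep d k (evolution A (fun i => c i ω) n) v) atTop
      (𝓝 (averageMap (haarSU d) (conjRep d k) continuous_conjRep v)) := by
    have h := tendsto_apply_of_basis (Module.finBasis ℂ (OperatorSpace d k))
      (F := fun N => (N : ℂ)⁻¹ • ∑ n ∈ Finset.range N,
        conjRep d k (evolution A (fun i => c i ω) n))
      (L := averageMap (haarSU d) (conjRep d k) continuous_conjRep)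
    simp only [LinearMap.smul_apply, LinearMap.sum_apply] at h
    exact h hbasis
  have hψ := hall (vecEquiv d k (tensorPow (ketbra ψ) k))
  refine tendsto_pi_nhds.2 fun a => tendsto_pi_nhds.2 fun b => ?_
  let π := (EuclideanSpace.proj (a, b) : OperatorSpace d k →L[ℂ] ℂ)
  have hπ : ∀ M, π (vecEquiv d k M) = M a b := fun M => rfl
  have hab := (π.continuous.tendsto _).comp hψ
  have hlim : π (averageMap (haarSU d) (conjRep d k) continuous_conjRep
      (vecEquiv d k (tensorPow (ketbra ψ) k))) = haarMoment k ψ a b := by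
    simp only [averageMap, LinearMap.coe_mk, AddHom.coe_mk, haarMoment, Matrix.of_apply]
    rw [← π.integral_comp_comm (integrable_orbit _ (continuous_conjRep _))]
    simp only [conjRep_vecEquiv_tensorPow, hπ]
  rw [hlim] at hab
  refine hab.congr fun N => ?_
  simp only [Function.comp_apply, conjRep_vecEquiv_tensorPow, ← map_sum, ← map_smul, hπ]
  rfl
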